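/- Let $n\ge 1$. For a permutation $\pi$ of $[n]=\{1,\dots,n\}$ let $O_\pi$ be the unitary on $\mathbb C^n$ with $O_\pi|i\rangle=|\pi(i)\rangle$ for all $i\in[n]$. A quantum query algorithm with $T$ queries acts on a work space $(\mathbb C^n\otimes\mathbb C^b)\oplus\mathbb C^c$ of finite dimension and, given an oracle $O\colon\mathbb C^n\to\mathbb C^n$, performs $$\mathcal A(O)=U_T\,\tilde O\,U_{T-1}\,\tilde O\cdots U_1\,\tilde O\,U_0,\qquad \tilde O=(O\otimes I_b)\oplus I_c,$$ where $U_0,\dots,U_T$ are unitaries that do not depend on $O$. Given oracles $(O_x)_{x\in D}$, it evaluates $f\colon D\to L$ (non-coherently) with error at most $\varepsilon$ if there are a unit vector $\xi$ and a projective measurement with outcomes in $L$, both independent of $x$, such that for every $x\in D$ measuring $\mathcal A(O_x)\xi$ gives $f(x)$ with probability at least $1-\varepsilon$. **Theorem.** (a) For every $\varepsilon<1/2$ there is a constant $c>0$, depending only on $\varepsilon$, such that for every $n\ge2$, every quantum query algorithm that, with unidirectional access (oracle $O_\pi$ only), evaluates $\pi\mapsto\pi^{-1}(1)$ over all permutations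 $\pi$ of $[n]$ with error at most $\varepsilon$ makes $T\ge c\sqrt n$ queries. In particular, finding $\pi^{-1}(1)$ with bounded error, even non-coherently, requires $\Omega(\sqrt n)$ queries to $O_\pi$. (b) In contrast, for every $n\ge1$ there is a quantum query algorithm that makes exactly one query, to the inverse oracle $O_\pi^*$, and evaluates $\pi\mapsto\pi^{-1}(1)$ with error $0$. -/

import Mathlib

open Matrix

/-- A quantum query algorithm with an oracle in `ℂ^m`.  Its work space is `(ℂ^m ⊗ ℂ^b) ⊕ ℂ^c`, with
computational basis `(m × Fin b) ⊕ Fin c`; it makes `T` queries, interleaved with the unitaries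
`U 0, …, U T`, which do not depend on the oracle. -/
structure QueryAlgorithm (m : Type) [Fintype m] [DecidableEq m] where
  /-- number of queries -/
  T : ℕ
  /-- dimension of the identity tensored with the oracle -/
  b : ℕ
  /-- dimension of the part of the work space on which the query is skipped -/
  c : ℕ
  U : Fin (T + 1) → Matrix.unitaryGroup ((m × Fin b) ⊕ Fin c) ℂ

namespace QueryAlgorithm

variable {m : Type} [Fintype m] [DecidableEq m]

/-- Basis labels of the work space. -/
abbrev Basis (A : QueryAlgorithm m) : Type := (m × Fin A.b) ⊕ Fin A.c

/-- One query: the operator `(O ⊗ I_b) ⊕ I_c` on the work space. -/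
noncomputable def query (A : QueryAlgorithm m) (O : Matrix m m ℂ) : Matrix A.Basis A.Basis ℂ :=
  Matrix.fromBlocks (Matrix.kronecker O (1 : Matrix (Fin A.b) (Fin A.b) ℂ)) 0 0 1

/-- The partial execution `U t * query * U (t - 1) * ⋯ * U 1 * query * U 0`. -/
noncomputable def partialRun (A : QueryAlgorithm m) (O : Matrix m m ℂ) (t : Fin (A.T + 1)) :
    Matrix A.Basis A.Basis ℂ :=
  Fin.induction (motive := fun _ => Matrix A.Basis A.Basis ℂ)
    (A.U 0 : Matrix A.Basis A.Basis ℂ)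
    (fun i M => (A.U i.succ : Matrix A.Basis A.Basis ℂ) * A.query O * M) t

/-- The operator `U T * query * U (T - 1) * ⋯ * U 1 * query * U 0` performed by the algorithm. -/
noncomputable def run (A : QueryAlgorithm m) (O : Matrix m m ℂ) : Matrix A.Basis A.Basis ℂ :=
  A.partialRun O (Fin.last A.T)

end QueryAlgorithm

/-- A projective measurement on `ℂ^κ` with outcomes in `L`. -/
structure ProjectiveMeasurement (κ L : Type) [Fintype κ] [DecidableEq κ] [Fintype L] where
  P : L → Matrix κ κ ℂ
  isStarProjection : ∀ l, IsStarProjection (P l)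
  orthogonal : ∀ k l, k ≠ l → P k * P l = 0
  sum_eq_one : ∑ l, P l = 1

/-- The probability of the outcome `l` when the state `ψ` is measured. -/
noncomputable def ProjectiveMeasurement.prob {κ L : Type} [Fintype κ] [DecidableEq κ] [Fintype L]
    (Q : ProjectiveMeasurement κ L) (ψ : κ → ℂ) (l : L) : ℝ :=
  ‖WithLp.toLp 2 (Q.P l *ᵥ ψ)‖ ^ 2

/-- The algorithm `A` evaluates the function `f : D → L` with error at most `ε` (in the non-coherent
sense) given the input oracles `O x`, `x : D`: for some initial unit vector and some measurement of
the final state, neither depending on `x`, the outcome is `f x` with probability at least `1 - ε`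
for every `x`.  The other degrees of freedom of the final state are not restricted. -/
def QueryAlgorithm.Evaluates {m : Type} [Fintype m] [DecidableEq m] {D L : Type} [Fintype L]
    (A : QueryAlgorithm m) (O : D → Matrix m m ℂ) (f : D → L) (ε : ℝ) : Prop :=
  ∃ ξ : EuclideanSpace ℂ A.Basis, ‖ξ‖ = 1 ∧
    ∃ Q : ProjectiveMeasurement A.Basis L,
      ∀ x : D, 1 - ε ≤ Q.prob (A.run (O x) *ᵥ ξ.ofLp) (f x)

/-- The unitary permutation oracle `|i⟩ ↦ |π i⟩` on `ℂ^n`. -/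
def permOracle {n : ℕ} (π : Equiv.Perm (Fin n)) : Matrix (Fin n) (Fin n) ℂ :=
  Matrix.of fun j i => if j = π i then 1 else 0

theorem permOracle_mulVec_single {n : ℕ} (π : Equiv.Perm (Fin n)) (i : Fin n) :
    permOracle π *ᵥ Pi.single i 1 = Pi.single (π i) 1 := by
  ext j
  simp [permOracle, Pi.single_apply]

/-- The function `π ↦ π⁻¹(1)`; the first element of `{1, …, n}` is `0 : Fin n`. -/
def preimageOfFirst {n : ℕ} (hn : 1 ≤ n) (π : Equiv.Perm (Fin n)) : Fin n :=
  π.symm ⟨0, hn⟩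

/-! For the lower bound, fix `π` and superpose the runs on the `n` inputs `swap z k * π`, where `z`
is the first element. These have pairwise different answers. The superposition has norm `n` before
any query; at the end its summands are nearly orthogonal, so its norm is at most `√n + n√ε`
(`l2norm_sum_le_of_prob`). One query lowers the norm by at most `2√n` plus the amplitude sitting on
`π⁻¹(z)` (`l2norm_sum_le_sum_query`). That amplitude can be large for a particular `π`, but averaged
over all `π` it is at most `√n` (`sum_sum_blockNorm_le`). Hence `n ≤ √n + n√ε + 3T√n`. -/

/-- The Euclidean norm of a complex coordinate vector. -/
noncomputable def l2norm {κ : Type} [Fintype κ] (v : κ → ℂ) : ℝ := ‖WithLp.toLp 2 v‖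

/-! ### Euclidean norm of coordinate vectors -/

section L2Norm

variable {κ : Type} [Fintype κ]

theorem l2norm_nonneg (v : κ → ℂ) : 0 ≤ l2norm v := norm_nonneg _

theorem l2norm_sq (v : κ → ℂ) : l2norm v ^ 2 = ∑ i, ‖v i‖ ^ 2 :=
  EuclideanSpace.norm_sq_eq _

theorem l2norm_add_le (v w : κ → ℂ) : l2norm (v + w) ≤ l2norm v + l2norm w :=
  norm_add_le (WithLp.toLp 2 v) (WithLp.toLp 2 w)

theorem l2norm_sub_le (v w : κ → ℂ) : l2norm (v - w) ≤ l2norm v + l2norm w :=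
  norm_sub_le (WithLp.toLp 2 v) (WithLp.toLp 2 w)

theorem l2norm_sum_le {ι : Type} (s : Finset ι) (v : ι → κ → ℂ) :
    l2norm (∑ i ∈ s, v i) ≤ ∑ i ∈ s, l2norm (v i) := by
  have := norm_sum_le s (fun i => WithLp.toLp 2 (v i))
  rwa [← WithLp.toLp_sum] at this

theorem star_dotProduct_self_eq_l2norm_sq (v : κ → ℂ) :
    star v ⬝ᵥ v = ((l2norm v ^ 2 : ℝ) : ℂ) := by
  rw [l2norm_sq]
  simp [dotProduct, Complex.conj_mul']

theorem l2norm_comp_equiv {κ' : Type} [Fintype κ'] (e : κ' ≃ κ) (v : κ → ℂ) :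
    l2norm (v ∘ e) = l2norm v := by
  rw [← sq_eq_sq₀ (l2norm_nonneg _) (l2norm_nonneg _), l2norm_sq, l2norm_sq]
  exact Equiv.sum_comp e (fun i => ‖v i‖ ^ 2)

theorem l2norm_le_of_norm_le {v w : κ → ℂ} (h : ∀ i, ‖v i‖ ≤ ‖w i‖) : l2norm v ≤ l2norm w := by
  refine le_of_sq_le_sq ?_ (l2norm_nonneg _)
  rw [l2norm_sq, l2norm_sq]
  exact Finset.sum_le_sum fun i _ => pow_le_pow_left₀ (norm_nonneg _) (h i) 2

theorem l2norm_unitary_mulVec [DecidableEq κ] (U : Matrix.unitaryGroup κ ℂ) (v : κ → ℂ) :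
    l2norm ((U : Matrix κ κ ℂ) *ᵥ v) = l2norm v := by
  rw [← sq_eq_sq₀ (l2norm_nonneg _) (l2norm_nonneg _)]
  have h : star ((U : Matrix κ κ ℂ) *ᵥ v) ⬝ᵥ ((U : Matrix κ κ ℂ) *ᵥ v) = star v ⬝ᵥ v := by
    rw [star_mulVec, ← dotProduct_mulVec, mulVec_mulVec, ← star_eq_conjTranspose,
      Matrix.UnitaryGroup.star_mul_self, one_mulVec]
  rw [star_dotProduct_self_eq_l2norm_sq, star_dotProduct_self_eq_l2norm_sq] at h
  exact_mod_cast h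

end L2Norm

/-! ### Projective measurements and near-orthogonality -/

namespace ProjectiveMeasurement

variable {κ L : Type} [Fintype κ] [DecidableEq κ] [Fintype L] (Q : ProjectiveMeasurement κ L)

theorem prob_eq (ψ : κ → ℂ) (l : L) : Q.prob ψ l = l2norm (Q.P l *ᵥ ψ) ^ 2 := rfl

theorem coe_prob (ψ : κ → ℂ) (l : L) : (Q.prob ψ l : ℂ) = star ψ ⬝ᵥ (Q.P l *ᵥ ψ) := by
  have hs : (Q.P l)ᴴ = Q.P l := (Q.isStarProjection l).isSelfAdjoint
  have hi : Q.P l * Q.P l = Q.P l := (Q.isStarProjection l).isIdempotentElem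
  rw [prob_eq, ← star_dotProduct_self_eq_l2norm_sq, star_mulVec, ← dotProduct_mulVec,
    mulVec_mulVec, hs, hi]

theorem sum_prob (ψ : κ → ℂ) : ∑ l, Q.prob ψ l = l2norm ψ ^ 2 := by
  have h : ((∑ l, Q.prob ψ l : ℝ) : ℂ) = ((l2norm ψ ^ 2 : ℝ) : ℂ) := by
    push_cast
    simp_rw [coe_prob]
    rw [← dotProduct_sum, ← sum_mulVec, Q.sum_eq_one, one_mulVec,
      star_dotProduct_self_eq_l2norm_sq]
    push_cast
    rfl
  exact_mod_cast h

theorem prob_nonneg (ψ : κ → ℂ) (l : L) : 0 ≤ Q.prob ψ l := sq_nonneg _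

theorem mulVec_sum_mulVec (φ : L → κ → ℂ) (l : L) :
    Q.P l *ᵥ ∑ k, Q.P k *ᵥ φ k = Q.P l *ᵥ φ l := by
  classical
  rw [mulVec_sum, Finset.sum_eq_single l]
  · rw [mulVec_mulVec, (Q.isStarProjection l).isIdempotentElem.eq]
  · intro k _ hk
    rw [mulVec_mulVec, Q.orthogonal l k hk.symm, zero_mulVec]
  · simp

theorem l2norm_sum_mulVec_sq (φ : L → κ → ℂ) :
    l2norm (∑ l, Q.P l *ᵥ φ l) ^ 2 = ∑ l, Q.prob (φ l) l := by
  rw [← Q.sum_prob]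
  refine Finset.sum_congr rfl fun l _ => ?_
  rw [prob_eq, mulVec_sum_mulVec, prob_eq]

/-- Pythagoras, read off from the outcome probabilities: subtracting the `l`-component removes
exactly the outcome `l`. -/
theorem l2norm_sub_mulVec_sq (ψ : κ → ℂ) (l : L) :
    l2norm (ψ - Q.P l *ᵥ ψ) ^ 2 = l2norm ψ ^ 2 - Q.prob ψ l := by
  classical
  have key (k : L) : Q.prob (ψ - Q.P l *ᵥ ψ) k = Q.prob ψ k - if k = l then Q.prob ψ l else 0 := by
    rw [prob_eq, mulVec_sub, mulVec_mulVec]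
    split_ifs with h
    · subst h
      rw [(Q.isStarProjection k).isIdempotentElem.eq]
      simp [l2norm]
    · rw [Q.orthogonal k l h, zero_mulVec, sub_zero, sub_zero, prob_eq]
  rw [← Q.sum_prob, ← Q.sum_prob, Finset.sum_congr rfl fun k _ => key k]
  simp

/-- The correct components `P l *ᵥ φ l` are mutually orthogonal, so their sum has norm at most the
root of the number of outcomes. The wrong components have norm at most `√ε` each and are summed by
the triangle inequality. -/
theorem l2norm_sum_le_of_prob {ε : ℝ} (φ : L → κ → ℂ) (hφ : ∀ l, l2norm (φ l) = 1)
    (h : ∀ l, 1 - ε ≤ Q.prob (φ l) l) :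
    l2norm (∑ l, φ l) ≤ √(Fintype.card L) + Fintype.card L * √ε := by
  have h1 : l2norm (∑ l, Q.P l *ᵥ φ l) ≤ √(Fintype.card L) := by
    apply Real.le_sqrt_of_sq_le
    rw [l2norm_sum_mulVec_sq]
    calc ∑ l, Q.prob (φ l) l ≤ ∑ _l : L, (1 : ℝ) := Finset.sum_le_sum fun l _ => by
          have := Q.l2norm_sub_mulVec_sq (φ l) l
          rw [hφ] at this
          nlinarith [sq_nonneg (l2norm (φ l - Q.P l *ᵥ φ l))]
      _ = _ := by simp
  have h2 : l2norm (∑ l, (φ l - Q.P l *ᵥ φ l)) ≤ Fintype.card L * √ε := by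
    calc _ ≤ ∑ l, l2norm (φ l - Q.P l *ᵥ φ l) := l2norm_sum_le _ _
      _ ≤ ∑ _l : L, √ε := Finset.sum_le_sum fun l _ => by
          apply Real.le_sqrt_of_sq_le
          rw [l2norm_sub_mulVec_sq, hφ]
          linarith [h l]
      _ = _ := by simp
  have h3 : ∑ l, φ l = ∑ l, Q.P l *ᵥ φ l + ∑ l, (φ l - Q.P l *ᵥ φ l) := by
    rw [← Finset.sum_add_distrib]
    simp
  rw [h3]
  exact (l2norm_add_le _ _).trans (add_le_add h1 h2)

theorem prob_add_prob_le (ψ : κ → ℂ) {k l : L} (hkl : k ≠ l) :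
    Q.prob ψ k + Q.prob ψ l ≤ l2norm ψ ^ 2 := by
  classical
  rw [← Q.sum_prob, ← Finset.sum_pair hkl]
  exact Finset.sum_le_sum_of_subset_of_nonneg (Finset.subset_univ _)
    fun _ _ _ => Q.prob_nonneg _ _

end ProjectiveMeasurement

/-! ### Effect of one query on a superposition of runs -/

section OneQuery

variable {n b c : ℕ}

/-- The norm of the part of a state in which the query register holds `i`. -/
noncomputable def blockNorm (v : (Fin n × Fin b) ⊕ Fin c → ℂ) (i : Fin n) : ℝ :=
  l2norm fun β => v (Sum.inl (i, β))

theorem sum_blockNorm_sq_le (v : (Fin n × Fin b) ⊕ Fin c → ℂ) :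
    ∑ i, blockNorm v i ^ 2 ≤ l2norm v ^ 2 := by
  simp_rw [blockNorm, l2norm_sq]
  rw [Fintype.sum_sum_type, Fintype.sum_prod_type]
  exact le_add_of_nonneg_right (Finset.sum_nonneg fun _ _ => sq_nonneg _)

theorem blockNorm_le (v : (Fin n × Fin b) ⊕ Fin c → ℂ) (i : Fin n) :
    blockNorm v i ≤ l2norm v := by
  refine le_of_sq_le_sq ?_ (l2norm_nonneg _)
  refine le_trans ?_ (sum_blockNorm_sq_le v)
  exact Finset.single_le_sum (f := fun i => blockNorm v i ^ 2) (fun _ _ => sq_nonneg _)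
    (Finset.mem_univ i)

theorem sum_blockNorm_le (v : (Fin n × Fin b) ⊕ Fin c → ℂ) (hv : l2norm v = 1) :
    ∑ i, blockNorm v i ≤ √n := by
  apply Real.le_sqrt_of_sq_le
  have h1 := sq_sum_le_card_mul_sum_sq (s := Finset.univ) (f := blockNorm v)
  have h2 := sum_blockNorm_sq_le v
  rw [hv] at h2
  simp only [Finset.card_univ, Fintype.card_fin] at h1
  nlinarith [(Nat.cast_nonneg n : (0 : ℝ) ≤ n)]

/-- The relabelling of the computational basis caused by one query to `π`. -/
def queryEquiv (b c : ℕ) (π : Equiv.Perm (Fin n)) : Equiv.Perm ((Fin n × Fin b) ⊕ Fin c) :=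
  Equiv.sumCongr (Equiv.prodCongr π (Equiv.refl _)) (Equiv.refl _)

/-- A query to each of the permutations `swap z k * π` can be told apart only on the block of `z`,
or by one of the summands in every other block. -/
theorem l2norm_sum_le_sum_query (z : Fin n) (π : Equiv.Perm (Fin n))
    (φ : Fin n → (Fin n × Fin b) ⊕ Fin c → ℂ) (hφ : ∀ k, l2norm (φ k) = 1) :
    l2norm (∑ k, φ k) ≤
      l2norm (∑ k, φ k ∘ (queryEquiv b c (Equiv.swap z k * π)).symm) +
        ∑ k, blockNorm (φ k) (π.symm z) + 2 * √n := by
  set S' := ∑ k, φ k ∘ (queryEquiv b c (Equiv.swap z k * π)).symm with hS'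
  -- The right side is compared with querying `π` in every summand, which preserves the norm of the
  -- sum. `R` is the queried sum without block `z`, `A k` restores block `z`, and `E₁ - E₂` corrects
  -- every block `y ≠ z`.
  let R : (Fin n × Fin b) ⊕ Fin c → ℂ :=
    Sum.elim (fun p => if p.1 = z then 0 else S' (Sum.inl p)) (fun q => S' (Sum.inr q))
  let A : Fin n → (Fin n × Fin b) ⊕ Fin c → ℂ := fun k =>
    Sum.elim (fun p => if p.1 = z then φ k (Sum.inl (π.symm z, p.2)) else 0) 0
  let E₁ : (Fin n × Fin b) ⊕ Fin c → ℂ :=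
    Sum.elim (fun p => if p.1 = z then 0 else φ p.1 (Sum.inl (π.symm p.1, p.2))) 0
  let E₂ : (Fin n × Fin b) ⊕ Fin c → ℂ :=
    Sum.elim (fun p => if p.1 = z then 0 else φ p.1 (Sum.inl (π.symm z, p.2))) 0
  have hR : l2norm R ≤ l2norm S' := by
    refine l2norm_le_of_norm_le ?_
    rintro (⟨y, β⟩ | q)
    · by_cases hy : y = z <;> simp [R, hy]
    · simp [R]
  have hA (k : Fin n) : l2norm (A k) ≤ blockNorm (φ k) (π.symm z) := by
    refine le_of_sq_le_sq ?_ (l2norm_nonneg _)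
    rw [blockNorm, l2norm_sq, l2norm_sq, Fintype.sum_sum_type, Fintype.sum_prod_type,
      Finset.sum_eq_single z]
    · simp [A]
    · intro y _ hy
      simp [A, hy]
    · simp
  -- Block `y` of the error involves only the unit vector `φ y`, so the `n` blocks contribute at
  -- most `1` each to the squared norm.
  have hE (E : (Fin n × Fin b) ⊕ Fin c → ℂ) (f : Fin n → Fin n)
      (h₁ : ∀ y β, ‖E (Sum.inl (y, β))‖ ≤ ‖φ y (Sum.inl (f y, β))‖)
      (h₂ : ∀ q, E (Sum.inr q) = 0) : l2norm E ≤ √n := by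
    apply Real.le_sqrt_of_sq_le
    rw [l2norm_sq, Fintype.sum_sum_type, Fintype.sum_prod_type]
    simp only [h₂, norm_zero, ne_eq, OfNat.ofNat_ne_zero, not_false_eq_true, zero_pow,
      Finset.sum_const_zero, add_zero]
    calc _ ≤ ∑ _y : Fin n, (1 : ℝ) := Finset.sum_le_sum fun y _ => by
          calc _ ≤ ∑ β, ‖φ y (Sum.inl (f y, β))‖ ^ 2 := Finset.sum_le_sum fun β _ =>
                pow_le_pow_left₀ (norm_nonneg _) (h₁ y β) 2
            _ = blockNorm (φ y) (f y) ^ 2 := (l2norm_sq _).symm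
            _ ≤ 1 ^ 2 := pow_le_pow_left₀ (l2norm_nonneg _) ((blockNorm_le _ _).trans_eq (hφ y)) 2
            _ = 1 := one_pow 2
      _ = n := by simp
  have hE₁ : l2norm E₁ ≤ √n := by
    refine hE E₁ π.symm (fun y β => ?_) (fun q => rfl)
    by_cases hy : y = z <;> simp [E₁, hy]
  have hE₂ : l2norm E₂ ≤ √n := by
    refine hE E₂ (fun _ => π.symm z) (fun y β => ?_) (fun q => rfl)
    by_cases hy : y = z <;> simp [E₂, hy]
  have hdec : (∑ k, φ k) ∘ (queryEquiv b c π).symm = R + ∑ k, A k + (E₁ - E₂) := by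
    funext x
    rcases x with ⟨y, β⟩ | q
    · by_cases hy : y = z
      · subst hy
        simp [R, A, E₁, E₂, queryEquiv, Finset.sum_apply]
      -- For `y ≠ z`, the preimage of `y` under `swap z k * π` is `π.symm y`, except for `k = y`,
      -- when it is `π.symm z`.
      · have h1 : S' (Sum.inl (y, β)) - φ y (Sum.inl (π.symm z, β)) =
            (∑ k, φ k (Sum.inl (π.symm y, β))) - φ y (Sum.inl (π.symm y, β)) := by
          rw [hS', Finset.sum_apply, ← Finset.sum_erase_add _ _ (Finset.mem_univ y),
            ← Finset.sum_erase_add Finset.univ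
              (fun k => φ k (Sum.inl (π.symm y, β))) (Finset.mem_univ y)]
          have h2 : ∀ k ∈ Finset.univ.erase y,
              (φ k ∘ (queryEquiv b c (Equiv.swap z k * π)).symm) (Sum.inl (y, β)) =
                φ k (Sum.inl (π.symm y, β)) := by
            intro k hk
            have hky : y ≠ k := (Finset.ne_of_mem_erase hk).symm
            have : (Equiv.swap z k * π).symm y = π.symm y := by
              rw [Equiv.symm_apply_eq]
              simp [Equiv.swap_apply_of_ne_of_ne hy hky]
            simp [queryEquiv, this]
          have h3 : (φ y ∘ (queryEquiv b c (Equiv.swap z y * π)).symm) (Sum.inl (y, β)) =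
              φ y (Sum.inl (π.symm z, β)) := by
            have : (Equiv.swap z y * π).symm y = π.symm z := by
              rw [Equiv.symm_apply_eq]
              simp
            simp [queryEquiv, this]
          rw [Finset.sum_congr rfl h2, h3]
          ring
        simp only [Function.comp_apply, queryEquiv, Finset.sum_apply, Pi.add_apply, Pi.sub_apply,
          R, A, E₁, E₂, Sum.elim_inl, hy, if_false, Finset.sum_const_zero, add_zero]
        simp only [Equiv.sumCongr_symm, Equiv.sumCongr_apply, Sum.map_inl, Equiv.prodCongr_symm,
          Equiv.prodCongr_apply, Prod.map_apply, Equiv.refl_symm, Equiv.refl_apply]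
        linear_combination -h1
    · simp [R, A, E₁, E₂, queryEquiv, Finset.sum_apply, hS']
  rw [← l2norm_comp_equiv (queryEquiv b c π).symm (∑ k, φ k), hdec]
  have h1 := l2norm_add_le (R + ∑ k, A k) (E₁ - E₂)
  have h2 := l2norm_add_le R (∑ k, A k)
  have h3 := l2norm_sub_le E₁ E₂
  have h4 := (l2norm_sum_le Finset.univ A).trans (Finset.sum_le_sum fun k _ => hA k)
  linarith

end OneQuery

/-! ### Progress of an algorithm, and the lower bound -/

namespace QueryAlgorithm

variable {n : ℕ} (A : QueryAlgorithm (Fin n))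

theorem query_permOracle_mulVec (π : Equiv.Perm (Fin n)) (v : A.Basis → ℂ) :
    A.query (permOracle π) *ᵥ v = v ∘ (queryEquiv A.b A.c π).symm := by
  have h (y i : Fin n) : y = π i ↔ i = π.symm y := by
    rw [Equiv.eq_symm_apply, eq_comm]
  funext x
  rcases x with ⟨y, β⟩ | q
  · simp [query, mulVec, dotProduct, Fintype.sum_sum_type, Fintype.sum_prod_type, permOracle,
      queryEquiv, kroneckerMap_apply, Matrix.one_apply, h]
  · simp [query, mulVec, dotProduct, Fintype.sum_sum_type, queryEquiv, Matrix.one_apply]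

/-- The state of the algorithm after `t` queries to `π`. -/
noncomputable def state (ξ : A.Basis → ℂ) (π : Equiv.Perm (Fin n)) (t : Fin (A.T + 1)) :
    A.Basis → ℂ :=
  A.partialRun (permOracle π) t *ᵥ ξ

theorem state_zero (ξ : A.Basis → ℂ) (π : Equiv.Perm (Fin n)) :
    A.state ξ π 0 = (A.U 0 : Matrix A.Basis A.Basis ℂ) *ᵥ ξ := rfl

theorem state_succ (ξ : A.Basis → ℂ) (π : Equiv.Perm (Fin n)) (i : Fin A.T) :
    A.state ξ π i.succ = (A.U i.succ : Matrix A.Basis A.Basis ℂ) *ᵥ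
      (A.state ξ π i.castSucc ∘ (queryEquiv A.b A.c π).symm) := by
  rw [← query_permOracle_mulVec, state, state, partialRun, Fin.induction_succ, ← mulVec_mulVec,
    ← mulVec_mulVec]
  rfl

theorem l2norm_state (ξ : A.Basis → ℂ) (π : Equiv.Perm (Fin n)) (t : Fin (A.T + 1)) :
    l2norm (A.state ξ π t) = l2norm ξ := by
  induction t using Fin.induction with
  | zero => rw [state_zero, l2norm_unitary_mulVec]
  | succ i ih => rw [state_succ, l2norm_unitary_mulVec, l2norm_comp_equiv, ih]

/-- The superposition of the states for the `n` permutations `swap z k * π`. -/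
noncomputable def swapSum (ξ : A.Basis → ℂ) (z : Fin n) (π : Equiv.Perm (Fin n))
    (t : Fin (A.T + 1)) : A.Basis → ℂ :=
  ∑ k, A.state ξ (Equiv.swap z k * π) t

theorem l2norm_swapSum_zero (ξ : A.Basis → ℂ) (hξ : l2norm ξ = 1) (z : Fin n)
    (π : Equiv.Perm (Fin n)) : l2norm (A.swapSum ξ z π 0) = n := by
  simp_rw [swapSum, state_zero]
  rw [Finset.sum_const, ← mulVec_smul, l2norm_unitary_mulVec, l2norm, WithLp.toLp_smul,
    Finset.card_univ, Fintype.card_fin, ← Nat.cast_smul_eq_nsmul ℝ, norm_smul]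
  change _ * l2norm ξ = _
  rw [hξ]
  simp

theorem l2norm_swapSum_le_succ (ξ : A.Basis → ℂ) (hξ : l2norm ξ = 1) (z : Fin n)
    (π : Equiv.Perm (Fin n)) (i : Fin A.T) :
    l2norm (A.swapSum ξ z π i.castSucc) ≤ l2norm (A.swapSum ξ z π i.succ) +
      ∑ k, blockNorm (A.state ξ (Equiv.swap z k * π) i.castSucc) (π.symm z) + 2 * √n := by
  have h := l2norm_sum_le_sum_query z π (fun k => A.state ξ (Equiv.swap z k * π) i.castSucc)
    (fun k => (A.l2norm_state ξ _ _).trans hξ)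
  refine h.trans_eq ?_
  congr 2
  simp_rw [swapSum, state_succ]
  rw [← mulVec_sum, l2norm_unitary_mulVec]

/-- Reindexing by `σ = swap z k * π` turns `π.symm z` into `σ.symm k`. For fixed `σ` the sum then
runs once over all blocks of a single unit vector, and Cauchy–Schwarz gives `√n`. -/
theorem sum_sum_blockNorm_le (ξ : A.Basis → ℂ) (hξ : l2norm ξ = 1) (z : Fin n)
    (t : Fin (A.T + 1)) :
    ∑ π : Equiv.Perm (Fin n), ∑ k,
      blockNorm (A.state ξ (Equiv.swap z k * π) t) (π.symm z) ≤ n.factorial * √n := by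
  have h1 : ∑ π : Equiv.Perm (Fin n), ∑ k,
      blockNorm (A.state ξ (Equiv.swap z k * π) t) (π.symm z) =
      ∑ π : Equiv.Perm (Fin n), ∑ k, blockNorm (A.state ξ π t) k := by
    calc _ = ∑ k, ∑ π : Equiv.Perm (Fin n), blockNorm (A.state ξ π t) (π.symm k) := by
          rw [Finset.sum_comm]
          refine Finset.sum_congr rfl fun k _ => ?_
          rw [← Equiv.sum_comp (Equiv.mulLeft (Equiv.swap z k))]
          refine Finset.sum_congr rfl fun π _ => ?_
          have : (Equiv.swap z k * π).symm z = π.symm k := by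
            rw [Equiv.symm_apply_eq]
            simp
          simp [this]
      _ = _ := by
          rw [Finset.sum_comm]
          exact Finset.sum_congr rfl fun π _ =>
            Equiv.sum_comp π.symm (fun k => blockNorm (A.state ξ π t) k)
  rw [h1]
  calc _ ≤ ∑ _π : Equiv.Perm (Fin n), √n := Finset.sum_le_sum fun π _ =>
        sum_blockNorm_le _ ((A.l2norm_state ξ π t).trans hξ)
    _ = _ := by simp [Fintype.card_perm]

theorem factorial_mul_le_sum_swapSum (ξ : A.Basis → ℂ) (hξ : l2norm ξ = 1) (z : Fin n)
    (t : Fin (A.T + 1)) :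
    (n.factorial : ℝ) * n ≤ ∑ π : Equiv.Perm (Fin n), l2norm (A.swapSum ξ z π t) +
      t.val * (n.factorial * (3 * √n)) := by
  induction t using Fin.induction with
  | zero =>
    simp_rw [A.l2norm_swapSum_zero ξ hξ]
    simp [Fintype.card_perm]
  | succ i ih =>
    have h1 := Finset.sum_le_sum fun (π : Equiv.Perm (Fin n)) (_ : π ∈ Finset.univ) =>
      A.l2norm_swapSum_le_succ ξ hξ z π i
    have h2 := A.sum_sum_blockNorm_le ξ hξ z i.castSucc
    rw [Finset.sum_add_distrib, Finset.sum_add_distrib, Finset.sum_const, Finset.card_univ,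
      Fintype.card_perm, Fintype.card_fin, nsmul_eq_mul] at h1
    simp only [Fin.val_succ, Fin.val_castSucc] at ih ⊢
    push_cast
    linarith

/-- Without queries the final state ignores the input, yet two different answers would both have
probability above `1/2`. This absorbs the additive `1` in `sqrt_mul_le_T`. -/
theorem one_le_T {ε : ℝ} (hε : ε < 1 / 2) (hn : 2 ≤ n)
    (h : A.Evaluates permOracle (preimageOfFirst (one_le_two.trans hn)) ε) : 1 ≤ A.T := by
  obtain ⟨ξ, hξ, Q, hQ⟩ := h
  by_contra hT
  have hlast : Fin.last A.T = 0 := by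
    ext
    simp
    omega
  have hrun (π : Equiv.Perm (Fin n)) :
      A.run (permOracle π) *ᵥ ξ.ofLp = (A.U 0 : Matrix A.Basis A.Basis ℂ) *ᵥ ξ.ofLp := by
    rw [run, hlast]
    rfl
  simp_rw [hrun] at hQ
  let z : Fin n := ⟨0, one_le_two.trans hn⟩
  let o : Fin n := ⟨1, hn⟩
  have h1 := hQ 1
  have h2 := hQ (Equiv.swap z o)
  have e1 : preimageOfFirst (one_le_two.trans hn) 1 = z := rfl
  have e2 : preimageOfFirst (one_le_two.trans hn) (Equiv.swap z o) = o := by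
    simp [preimageOfFirst, z, Equiv.symm_swap]
  rw [e1] at h1
  rw [e2] at h2
  have hzo : z ≠ o := by simp [z, o]
  have h3 := Q.prob_add_prob_le ((A.U 0 : Matrix A.Basis A.Basis ℂ) *ᵥ ξ.ofLp) hzo
  have hξ' : l2norm ξ.ofLp = 1 := hξ
  rw [l2norm_unitary_mulVec, hξ'] at h3
  linarith

theorem sqrt_mul_le_T {ε : ℝ} (hn : 1 ≤ n)
    (h : A.Evaluates permOracle (preimageOfFirst hn) ε) :
    (1 - √ε) * √n ≤ 1 + 3 * A.T := by
  obtain ⟨ξ, hξ, Q, hQ⟩ := h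
  have hξ' : l2norm ξ.ofLp = 1 := hξ
  have hfinal (π : Equiv.Perm (Fin n)) :
      l2norm (A.swapSum ξ.ofLp ⟨0, hn⟩ π (Fin.last A.T)) ≤ √n + n * √ε := by
    -- Substituting `k = π l` labels each summand by its correct answer `l`.
    rw [swapSum, ← Equiv.sum_comp π]
    have := Q.l2norm_sum_le_of_prob (ε := ε)
      (fun l => A.state ξ.ofLp (Equiv.swap ⟨0, hn⟩ (π l) * π) (Fin.last A.T))
      (fun l => (A.l2norm_state _ _ _).trans hξ') (fun l => by
        have h1 := hQ (Equiv.swap ⟨0, hn⟩ (π l) * π)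
        have h2 : preimageOfFirst hn (Equiv.swap ⟨0, hn⟩ (π l) * π) = l := by
          rw [preimageOfFirst, Equiv.symm_apply_eq]
          simp
        rw [h2] at h1
        exact h1)
    simpa using this
  have h1 := A.factorial_mul_le_sum_swapSum ξ.ofLp hξ' ⟨0, hn⟩ (Fin.last A.T)
  have h2 := Finset.sum_le_sum fun (π : Equiv.Perm (Fin n)) (_ : π ∈ Finset.univ) => hfinal π
  rw [Finset.sum_const, Finset.card_univ, Fintype.card_perm, Fintype.card_fin, nsmul_eq_mul] at h2
  have hf : (0 : ℝ) < n.factorial := by exact_mod_cast n.factorial_pos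
  have hs : 0 < √(n : ℝ) := Real.sqrt_pos.2 (by exact_mod_cast hn)
  have hss : √(n : ℝ) * √n = n := Real.mul_self_sqrt (Nat.cast_nonneg n)
  have h3 : (n : ℝ) ≤ √n + n * √ε + A.T * (3 * √n) := by
    refine le_of_mul_le_mul_left ?_ hf
    rw [Fin.val_last] at h1
    linarith
  refine le_of_mul_le_mul_right ?_ hs
  calc (1 - √ε) * √n * √n = n - n * √ε := by rw [mul_assoc, hss]; ring
    _ ≤ (1 + 3 * A.T) * √n := by linarith

end QueryAlgorithm

/-! ### The one-query algorithm with the inverse oracle -/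

/-- The measurement in the computational basis, followed by the map `f` on its outcomes. -/
def basisMeasurement {κ L : Type} [Fintype κ] [DecidableEq κ] [Fintype L] [DecidableEq L]
    (f : κ → L) : ProjectiveMeasurement κ L where
  P l := Matrix.diagonal fun x => if f x = l then 1 else 0
  isStarProjection l := by
    constructor
    · rw [IsIdempotentElem, diagonal_mul_diagonal]
      congr 1
      funext x
      split_ifs <;> simp
    · rw [IsSelfAdjoint, star_eq_conjTranspose, diagonal_conjTranspose]
      congr 1
      funext x
      rw [Pi.star_apply]
      split_ifs <;> simp
  orthogonal k l hkl := by
    rw [diagonal_mul_diagonal, ← diagonal_zero]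
    congr 1
    funext x
    by_cases h : f x = k
    · have : f x ≠ l := fun h' => hkl (h.symm.trans h')
      simp [this]
    · simp [h]
  sum_eq_one := by
    ext x y
    rw [Matrix.sum_apply]
    by_cases h : x = y
    · subst h
      simp
    · simp [h]

theorem prob_basisMeasurement_single {κ L : Type} [Fintype κ] [DecidableEq κ] [Fintype L]
    [DecidableEq L] (f : κ → L) (x : κ) :
    (basisMeasurement f).prob (Pi.single x 1) (f x) = 1 := by
  rw [ProjectiveMeasurement.prob_eq, l2norm_sq, Finset.sum_eq_single x]
  · simp [basisMeasurement, mulVec_diagonal]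
  · intro y _ hy
    simp [basisMeasurement, mulVec_diagonal, hy]
  · simp

theorem single_comp_symm {κ : Type} [DecidableEq κ] (σ : Equiv.Perm κ) (x : κ) :
    (Pi.single x 1 : κ → ℂ) ∘ σ.symm = Pi.single (σ x) 1 := by
  funext y
  simp [Pi.single_apply, Equiv.symm_apply_eq]

/-- The algorithm that makes a single query, with no further operation. -/
def singleQuery (n : ℕ) : QueryAlgorithm (Fin n) where
  T := 1
  b := 1
  c := 0
  U _ := 1

theorem conjTranspose_permOracle {n : ℕ} (π : Equiv.Perm (Fin n)) :
    (permOracle π)ᴴ = permOracle π.symm := by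
  ext i j
  simp [permOracle, Matrix.conjTranspose_apply, apply_ite, Equiv.eq_symm_apply, eq_comm]

theorem singleQuery_evaluates {n : ℕ} (hn : 1 ≤ n) :
    (singleQuery n).Evaluates (fun π => (permOracle π)ᴴ) (preimageOfFirst hn) 0 := by
  let e : Fin n → (singleQuery n).Basis := fun i => Sum.inl (i, (0 : Fin 1))
  let f : (singleQuery n).Basis → Fin n := Sum.elim Prod.fst Fin.elim0
  refine ⟨EuclideanSpace.single (e ⟨0, hn⟩) 1, by simp, basisMeasurement f, fun π => ?_⟩
  have hrun : (singleQuery n).run (permOracle π)ᴴ *ᵥ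
      (EuclideanSpace.single (e ⟨0, hn⟩) (1 : ℂ)).ofLp = Pi.single (e (π.symm ⟨0, hn⟩)) 1 := by
    rw [conjTranspose_permOracle]
    refine ((singleQuery n).state_succ _ π.symm (0 : Fin 1)).trans ?_
    refine (one_mulVec _).trans ?_
    refine (congrArg (· ∘ (queryEquiv 1 0 π.symm).symm) (one_mulVec _)).trans ?_
    exact single_comp_symm (queryEquiv 1 0 π.symm) (Sum.inl (⟨0, hn⟩, 0))
  have hp := prob_basisMeasurement_single f (e (π.symm ⟨0, hn⟩))
  have he : f (e (π.symm ⟨0, hn⟩)) = preimageOfFirst hn π := rfl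
  rw [he] at hp
  rw [hrun, hp, sub_zero]

theorem mainTheorem7 :
    (∀ ε : ℝ, ε < 1 / 2 → ∃ c : ℝ, 0 < c ∧
      ∀ (n : ℕ) (hn : 2 ≤ n) (A : QueryAlgorithm (Fin n)),
        A.Evaluates permOracle (preimageOfFirst (one_le_two.trans hn)) ε →
          c * Real.sqrt n ≤ (A.T : ℝ)) ∧
    (∀ (n : ℕ) (hn : 1 ≤ n), ∃ A : QueryAlgorithm (Fin n), A.T = 1 ∧
      A.Evaluates (fun π => (permOracle π)ᴴ) (preimageOfFirst hn) 0) := by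
  -- The `4` comes from `1 + 3T ≤ 4T`, valid since `T ≥ 1`.
  refine ⟨fun ε hε => ⟨(1 - √ε) / 4, ?_, fun n hn A hA => ?_⟩,
    fun n hn => ⟨singleQuery n, rfl, singleQuery_evaluates hn⟩⟩
  · have : √ε < 1 := by
      rw [Real.sqrt_lt' one_pos]
      linarith
    linarith
  · have h1 := A.sqrt_mul_le_T (one_le_two.trans hn) hA
    have h2 : (1 : ℝ) ≤ A.T := by exact_mod_cast A.one_le_T hε hn hA
    linarith
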